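/- Fix a universe of small sets, and let $\mathcal{C}$ be an essentially small $\infty$-category (a quasi-category, possibly living in a larger universe, that is equivalent to a small one) which has all small limits or all small colimits. Then for any two objects $X, Y \in \mathcal{C}$ the mapping space $\operatorname{Map}_{\mathcal{C}}(X,Y)$ is either empty or contractible. -/

import Mathlib

open CategoryTheory Opposite Simplicial MonoidalCategory

universe v w

namespace InftyCat

/-! Ordinal sum `[m] ⋆ [n] = [m + n + 1]` in the simplex category, with its two inclusions
`inl' : [m] ⟶ [m] ⋆ [n]` (initial segment) and `inr' : [n] ⟶ [m] ⋆ [n]` (final segment),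
is Mathlib's `AugmentedSimplexCategory.tensorObjOf`, and `tensorHomOf f g` is `f ⋆ g`. -/

open AugmentedSimplexCategory

lemma inl_comp {m m' n n' : SimplexCategory} (f : m ⟶ m') (g : n ⟶ n') :
    inl' m n ≫ tensorHomOf f g = f ≫ inl' m' n' :=
  inl_comp_tensorHom (x₁ := .of m) (y₁ := .of m') (x₂ := .of n) (y₂ := .of n') f g

lemma inr_comp {m m' n n' : SimplexCategory} (f : m ⟶ m') (g : n ⟶ n') :
    inr' m n ≫ tensorHomOf f g = g ≫ inr' m' n' :=
  inr_comp_tensorHom (x₁ := .of m) (y₁ := .of m') (x₂ := .of n) (y₂ := .of n') f g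

lemma sum_comp {m m' m'' n n' n'' : SimplexCategory} (f : m ⟶ m') (f' : m' ⟶ m'')
    (g : n ⟶ n') (g' : n' ⟶ n'') :
    tensorHomOf f g ≫ tensorHomOf f' g' = tensorHomOf (f ≫ f') (g ≫ g') :=
  AugmentedSimplexCategory.tensorHom_comp_tensorHom (x₁ := .of m) (y₁ := .of m') (z₁ := .of m'')
    (x₂ := .of n) (y₂ := .of n') (z₂ := .of n'') f g f' g'

lemma sum_id (m n : SimplexCategory) : tensorHomOf (𝟙 m) (𝟙 n) = 𝟙 (tensorObjOf m n) :=
  tensor_id (.of m) (.of n)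

/-! ### Slices -/

/-- An `n`-simplex of the slice `C_{/p}` over a diagram `p : K ⟶ C`, that is, a map
`Δⁿ ⋆ K ⟶ C` from the join whose restriction to `K` is `p`. Besides the simplices of `Δⁿ` and
those of `K`, the join has a simplex `α ⋆ k : Δⁱ ⋆ Δʲ ⟶ Δⁿ ⋆ K` for all `α : [i] ⟶ [n]` and
`k ∈ K_j`, and it is a face or degeneracy of `id ⋆ k`. So such a map consists of the image `vert`
of the top simplex of `Δⁿ` and, naturally in `k ∈ K_j`, an `(n+1+j)`-simplex `cell k` (the image
of `id ⋆ k`) with initial segment `vert` and final segment `p k`. -/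
@[ext]
structure OverSimplex {K C : SSet.{v}} (p : K ⟶ C) (n : SimplexCategory) where
  vert : C.obj (op n)
  cell : ∀ j : SimplexCategory, K.obj (op j) → C.obj (op (tensorObjOf n j))
  cell_natural : ∀ (j j' : SimplexCategory) (g : j' ⟶ j) (k : K.obj (op j)),
    cell j' (K.map g.op k) = C.map (tensorHomOf (𝟙 n) g).op (cell j k)
  cell_left : ∀ (j : SimplexCategory) (k : K.obj (op j)), C.map (inl' n j).op (cell j k) = vert
  cell_right : ∀ (j : SimplexCategory) (k : K.obj (op j)),
    C.map (inr' n j).op (cell j k) = p.app (op j) k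

/-- An `n`-simplex of the slice `C_{p/}` under a diagram `p : K ⟶ C`, that is, a map
`K ⋆ Δⁿ ⟶ C` from the join whose restriction to `K` is `p`; it is given by the image `vert`
of the top simplex of `Δⁿ` and, naturally in `k ∈ K_j`, a `(j+1+n)`-simplex `cell k` (the image of
`k ⋆ id`) with initial segment `p k` and final segment `vert`. -/
@[ext]
structure UnderSimplex {K C : SSet.{v}} (p : K ⟶ C) (n : SimplexCategory) where
  vert : C.obj (op n)
  cell : ∀ j : SimplexCategory, K.obj (op j) → C.obj (op (tensorObjOf j n))
  cell_natural : ∀ (j j' : SimplexCategory) (g : j' ⟶ j) (k : K.obj (op j)),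
    cell j' (K.map g.op k) = C.map (tensorHomOf g (𝟙 n)).op (cell j k)
  cell_left : ∀ (j : SimplexCategory) (k : K.obj (op j)),
    C.map (inl' j n).op (cell j k) = p.app (op j) k
  cell_right : ∀ (j : SimplexCategory) (k : K.obj (op j)), C.map (inr' j n).op (cell j k) = vert

/-- Restriction of `Δⁿ ⋆ K ⟶ C` along `f ⋆ id`. -/
def OverSimplex.restrict {K C : SSet.{v}} {p : K ⟶ C} {m n : SimplexCategory}
    (s : OverSimplex p n) (f : m ⟶ n) : OverSimplex p m where
  vert := C.map f.op s.vert
  cell j k := C.map (tensorHomOf f (𝟙 j)).op (s.cell j k)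
  cell_natural j j' g k := by
    simp only [s.cell_natural, ← Functor.map_comp_apply, ← op_comp, sum_comp, Category.id_comp,
      Category.comp_id]
  cell_left j k := by
    rw [← s.cell_left j k]
    simp only [← Functor.map_comp_apply, ← op_comp, inl_comp]
  cell_right j k := by
    rw [← s.cell_right j k]
    simp only [← Functor.map_comp_apply, ← op_comp, inr_comp, Category.id_comp]

/-- Restriction of `K ⋆ Δⁿ ⟶ C` along `id ⋆ f`. -/
def UnderSimplex.restrict {K C : SSet.{v}} {p : K ⟶ C} {m n : SimplexCategory}
    (s : UnderSimplex p n) (f : m ⟶ n) : UnderSimplex p m where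
  vert := C.map f.op s.vert
  cell j k := C.map (tensorHomOf (𝟙 j) f).op (s.cell j k)
  cell_natural j j' g k := by
    simp only [s.cell_natural, ← Functor.map_comp_apply, ← op_comp, sum_comp, Category.id_comp,
      Category.comp_id]
  cell_left j k := by
    rw [← s.cell_left j k]
    simp only [← Functor.map_comp_apply, ← op_comp, inl_comp, Category.id_comp]
  cell_right j k := by
    rw [← s.cell_right j k]
    simp only [← Functor.map_comp_apply, ← op_comp, inr_comp]

lemma OverSimplex.restrict_id {K C : SSet.{v}} {p : K ⟶ C} {n : SimplexCategory}
    (s : OverSimplex p n) : s.restrict (𝟙 n) = s := by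
  apply OverSimplex.ext
  · simp [OverSimplex.restrict]
  · funext j k
    simp [OverSimplex.restrict, sum_id]

lemma OverSimplex.restrict_comp {K C : SSet.{v}} {p : K ⟶ C} {l m n : SimplexCategory}
    (s : OverSimplex p n) (g : l ⟶ m) (f : m ⟶ n) :
    s.restrict (g ≫ f) = (s.restrict f).restrict g := by
  apply OverSimplex.ext
  · simp [OverSimplex.restrict]
  · funext j k
    simp only [OverSimplex.restrict, ← Functor.map_comp_apply, ← op_comp, sum_comp,
      Category.id_comp]

/-- The slice `C_{/p}`: maps `A ⟶ C_{/p}` are maps `A ⋆ K ⟶ C` restricting to `p` on `K`. -/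
def overSlice {K C : SSet.{v}} (p : K ⟶ C) : SSet.{v} where
  obj n := OverSimplex p n.unop
  map f := TypeCat.ofHom fun s => s.restrict f.unop
  map_id _ := by
    ext s : 3
    exact s.restrict_id
  map_comp f g := by
    ext s : 3
    exact s.restrict_comp g.unop f.unop

lemma UnderSimplex.restrict_id {K C : SSet.{v}} {p : K ⟶ C} {n : SimplexCategory}
    (s : UnderSimplex p n) : s.restrict (𝟙 n) = s := by
  apply UnderSimplex.ext
  · simp [UnderSimplex.restrict]
  · funext j k
    simp [UnderSimplex.restrict, sum_id]

lemma UnderSimplex.restrict_comp {K C : SSet.{v}} {p : K ⟶ C} {l m n : SimplexCategory}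
    (s : UnderSimplex p n) (g : l ⟶ m) (f : m ⟶ n) :
    s.restrict (g ≫ f) = (s.restrict f).restrict g := by
  apply UnderSimplex.ext
  · simp [UnderSimplex.restrict]
  · funext j k
    simp only [UnderSimplex.restrict, ← Functor.map_comp_apply, ← op_comp, sum_comp,
      Category.id_comp]

/-- The slice `C_{p/}`: maps `A ⟶ C_{p/}` are maps `K ⋆ A ⟶ C` restricting to `p` on `K`. -/
def underSlice {K C : SSet.{v}} (p : K ⟶ C) : SSet.{v} where
  obj n := UnderSimplex p n.unop
  map f := TypeCat.ofHom fun s => s.restrict f.unop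
  map_id _ := by
    ext s : 3
    exact s.restrict_id
  map_comp f g := by
    ext s : 3
    exact s.restrict_comp g.unop f.unop

/-! ### Limits and colimits -/

/-- The `i`-th vertex of `∂Δⁿ⁺¹`. -/
def boundaryVertex (n : ℕ) (i : Fin (n + 2)) : (∂Δ[n + 1] : SSet.{v}) _⦋0⦌ :=
  ⟨SSet.stdSimplex.obj₀Equiv.symm i, by
    rw [SSet.boundary_obj_eq_univ 0 (n + 1)]
    trivial⟩

/-- `x` is a final object: for `n ≥ 1`, every map `∂Δⁿ ⟶ S` whose last vertex is `x` extends to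
`Δⁿ`, that is, `S_{/x} ⟶ S` is a trivial fibration. -/
def IsFinal {S : SSet.{v}} (x : S _⦋0⦌) : Prop :=
  ∀ (n : ℕ) (f : (∂Δ[n + 1] : SSet.{v}) ⟶ S),
    f.app (op ⦋0⦌) (boundaryVertex n (Fin.last (n + 1))) = x →
      ∃ g : Δ[n + 1] ⟶ S, ∂Δ[n + 1].ι ≫ g = f

/-- `x` is an initial object: for `n ≥ 1`, every map `∂Δⁿ ⟶ S` whose zeroth vertex is `x` extends
to `Δⁿ`, that is, `S_{x/} ⟶ S` is a trivial fibration. -/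
def IsInitial {S : SSet.{v}} (x : S _⦋0⦌) : Prop :=
  ∀ (n : ℕ) (f : (∂Δ[n + 1] : SSet.{v}) ⟶ S),
    f.app (op ⦋0⦌) (boundaryVertex n 0) = x →
      ∃ g : Δ[n + 1] ⟶ S, ∂Δ[n + 1].ι ≫ g = f

/-- A diagram has a limit if the slice over it has a final object. -/
def HasLimit {K C : SSet.{v}} (p : K ⟶ C) : Prop :=
  ∃ x : (overSlice p) _⦋0⦌, IsFinal x

/-- A diagram has a colimit if the slice under it has an initial object. -/
def HasColimit {K C : SSet.{v}} (p : K ⟶ C) : Prop :=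
  ∃ x : (underSlice p) _⦋0⦌, IsInitial x

/-- A simplicial set is `w`-small if all its sets of simplices are (bijective to sets) in the
universe `w`. -/
def IsSmall (K : SSet.{v}) : Prop :=
  ∀ n : SimplexCategory, Small.{w} (K.obj (op n))

/-- All diagrams indexed by `w`-small simplicial sets have limits. (For `w ≤ v` every `w`-small
simplicial set is isomorphic to one in `SSet.{v}`.) -/
def HasSmallLimits (C : SSet.{v}) : Prop :=
  ∀ (K : SSet.{v}), IsSmall.{v, w} K → ∀ p : K ⟶ C, HasLimit p

/-- All diagrams indexed by `w`-small simplicial sets have colimits. (For `w ≤ v` every `w`-small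
simplicial set is isomorphic to one in `SSet.{v}`.) -/
def HasSmallColimits (C : SSet.{v}) : Prop :=
  ∀ (K : SSet.{v}), IsSmall.{v, w} K → ∀ p : K ⟶ C, HasColimit p

/-! ### Essentially small ∞-categories -/

/-- Functors `f g : C ⟶ D` are naturally equivalent if they are connected by an isomorphism in
the functor ∞-category `Fun(C, D)`, that is, by a map from the nerve of the walking isomorphism
to `Fun(C, D)`. -/
def NaturallyEquivalent {C D : SSet.{v}} (f g : C ⟶ D) : Prop :=
  ∃ h : C ⊗ SSet.coherentIso.{v} ⟶ D,
    CartesianMonoidalCategory.lift (𝟙 C) (SSet.const SSet.coherentIso.x₀) ≫ h = f ∧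
    CartesianMonoidalCategory.lift (𝟙 C) (SSet.const SSet.coherentIso.x₁) ≫ h = g

/-- A functor of ∞-categories is an equivalence if it has an inverse up to natural equivalence. -/
def IsEquivalence {C D : SSet.{v}} (F : C ⟶ D) : Prop :=
  ∃ G : D ⟶ C, NaturallyEquivalent (F ≫ G) (𝟙 C) ∧ NaturallyEquivalent (G ≫ F) (𝟙 D)

/-- An ∞-category is essentially `w`-small if it is equivalent to a `w`-small ∞-category. -/
def IsEssentiallySmall (C : SSet.{v}) : Prop :=
  ∃ D : SSet.{v}, D.Quasicategory ∧ IsSmall.{v, w} D ∧ ∃ F : D ⟶ C, IsEquivalence F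

/-! ### Mapping spaces -/

/-- The mapping space `Map(X, Y)`, in the model `Hom^L(X, Y)`: an `n`-simplex is an
`(n+1)`-simplex of `C`, written as `[0] ⋆ [n]`, whose zeroth vertex is `X` and whose face on the
remaining vertices is constant at `Y`. -/
def mapSpace {C : SSet.{v}} (X Y : C _⦋0⦌) : SSet.{v} where
  obj n := {z : C.obj (op (tensorObjOf ⦋0⦌ n.unop)) //
    C.map (inl' ⦋0⦌ n.unop).op z = X ∧
    C.map (inr' ⦋0⦌ n.unop).op z = C.map (SimplexCategory.const n.unop ⦋0⦌ 0).op Y}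
  map f := TypeCat.ofHom fun z => ⟨C.map (tensorHomOf (𝟙 ⦋0⦌) f.unop).op z.1, by
    refine Eq.trans ?_ z.2.1
    simp only [← Functor.map_comp_apply, ← op_comp, inl_comp, Category.id_comp], by
    rw [← Functor.map_comp_apply, ← op_comp, inr_comp, op_comp, Functor.map_comp_apply, z.2.2]
    simp only [← Functor.map_comp_apply, ← op_comp]
    rfl⟩
  map_id n := by
    ext z : 3
    apply Subtype.ext
    simp [sum_id]
  map_comp f g := by
    ext z : 3
    apply Subtype.ext
    change C.map _ _ = C.map _ (C.map _ _)
    simp only [← Functor.map_comp_apply, ← op_comp, sum_comp, Category.id_comp, unop_comp]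

/-- A simplicial set is a contractible Kan complex if for every `n ≥ 0` every map `∂Δⁿ ⟶ S`
extends to `Δⁿ`, that is, if `S ⟶ Δ⁰` is a trivial fibration. -/
def IsContractible (S : SSet.{v}) : Prop :=
  ∀ (n : ℕ) (f : (∂Δ[n] : SSet.{v}) ⟶ S), ∃ g : Δ[n] ⟶ S, ∂Δ[n].ι ≫ g = f

end InftyCat

namespace InftyCat

open AugmentedSimplexCategory

/-! ### Faces and degeneracies indexed by natural numbers -/

/-! This is the higher form of Freyd's argument that a small category with small products is a
preorder. The core is that every map `∂Δⁿ⁺² ⟶ C` extends to the simplex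
(`exists_filler_of_hasSmallLimits_or_hasSmallColimits`). A sphere in a mapping space is a sphere of
one dimension more in `C`, so a nonempty mapping space is then contractible
(`isContractible_mapSpace`).

To fill a sphere, fill an inner horn of it. The face `a` so obtained and the prescribed face `b`
have the same boundary. Let `F : D ⟶ C` be an equivalence from a small ∞-category, with inverse `G`,
and let `I` be the set of `(n + 1)`-simplices of `D`. A power (or copower) indexed by `I` assembles,
for every `A ⊆ I`, the family equal to `a` on `A` and to `b` elsewhere into one simplex `t A` of
`C`, from which the family is recovered by projection (`exists_comparison`). By Cantor, `G (t A) = G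
(t B)` for some `A ≠ B`, and an index separating `A` from `B` shows that the images of `a` and `b`
under `G ≫ F` are interchangeable (`exists_replace_face`). This fills the image of the sphere under
`G ≫ F`, and the natural equivalence with the identity brings the filler back
(`NaturallyEquivalent.exists_filler`). -/

/-- The `i`-th face of a simplex; meaningful for `i ≤ n + 1`. -/
def face {S : SSet.{v}} {n : ℕ} (i : ℕ) (x : S _⦋n + 1⦌) : S _⦋n⦌ :=
  S.δ (Fin.ofNat (n + 2) i) x

/-- The `i`-th degeneracy of a simplex; meaningful for `i ≤ n`. -/
def degen {S : SSet.{v}} {n : ℕ} (i : ℕ) (x : S _⦋n⦌) : S _⦋n + 1⦌ :=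
  S.σ (Fin.ofNat (n + 1) i) x

lemma face_val {S : SSet.{v}} {n : ℕ} (i : Fin (n + 2)) (x : S _⦋n + 1⦌) :
    face i.val x = S.δ i x := by
  simp [face]

lemma face_of_lt {S : SSet.{v}} {n i : ℕ} (hi : i < n + 2) (x : S _⦋n + 1⦌) :
    face i x = S.δ ⟨i, hi⟩ x :=
  face_val ⟨i, hi⟩ x

lemma degen_of_lt {S : SSet.{v}} {n i : ℕ} (hi : i < n + 1) (x : S _⦋n⦌) :
    degen i x = S.σ ⟨i, hi⟩ x := by
  have : Fin.ofNat (n + 1) i = ⟨i, hi⟩ := by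
    ext
    simpa using Nat.mod_eq_of_lt hi
  rw [degen, this]

lemma face_face {S : SSet.{v}} {n i j : ℕ} (hij : i ≤ j) (hj : j ≤ n + 1) (x : S _⦋n + 2⦌) :
    face i (face (j + 1) x) = face j (face i x) := by
  rw [face_of_lt (show i < n + 2 by omega), face_of_lt (show j + 1 < n + 3 by omega),
    face_of_lt (show j < n + 2 by omega), face_of_lt (show i < n + 3 by omega)]
  exact ConcreteCategory.congr_hom
    (S.δ_comp_δ (i := ⟨i, by omega⟩) (j := ⟨j, by omega⟩) hij) x

lemma face_degen_self {S : SSet.{v}} {n i : ℕ} (hi : i ≤ n) (x : S _⦋n⦌) :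
    face i (degen i x) = x := by
  rw [face_of_lt (show i < n + 2 by omega), degen_of_lt (show i < n + 1 by omega)]
  exact ConcreteCategory.congr_hom (S.δ_comp_σ_self (i := ⟨i, by omega⟩)) x

lemma face_degen_succ {S : SSet.{v}} {n i : ℕ} (hi : i ≤ n) (x : S _⦋n⦌) :
    face (i + 1) (degen i x) = x := by
  rw [face_of_lt (show i + 1 < n + 2 by omega), degen_of_lt (show i < n + 1 by omega)]
  exact ConcreteCategory.congr_hom (S.δ_comp_σ_succ (i := ⟨i, by omega⟩)) x

lemma face_degen_of_lt {S : SSet.{v}} {n i j : ℕ} (hij : i ≤ j) (hj : j ≤ n) (x : S _⦋n + 1⦌) :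
    face i (degen (j + 1) x) = degen j (face i x) := by
  rw [face_of_lt (show i < n + 3 by omega), degen_of_lt (show j + 1 < n + 2 by omega),
    face_of_lt (show i < n + 2 by omega), degen_of_lt (show j < n + 1 by omega)]
  exact ConcreteCategory.congr_hom
    (S.δ_comp_σ_of_le (i := ⟨i, by omega⟩) (j := ⟨j, by omega⟩) hij) x

lemma face_degen_of_gt {S : SSet.{v}} {n i j : ℕ} (hij : j < i) (hi : i ≤ n + 1)
    (x : S _⦋n + 1⦌) :
    face (i + 1) (degen j x) = degen j (face i x) := by
  rw [face_of_lt (show i + 1 < n + 3 by omega), degen_of_lt (show j < n + 2 by omega),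
    face_of_lt (show i < n + 2 by omega), degen_of_lt (show j < n + 1 by omega)]
  exact ConcreteCategory.congr_hom
    (S.δ_comp_σ_of_gt (i := ⟨i, by omega⟩) (j := ⟨j, by omega⟩) hij) x

lemma app_face {S T : SSet.{v}} (f : S ⟶ T) {n : ℕ} (i : ℕ) (x : S _⦋n + 1⦌) :
    f.app (op ⦋n⦌) (face i x) = face i (f.app (op ⦋n + 1⦌) x) :=
  ConcreteCategory.congr_hom (f.naturality (SimplexCategory.δ (Fin.ofNat (n + 2) i)).op) x

/-- The family `x 0, …, x (n + 1)` of `n`-simplices is the family of faces of a map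
`∂Δⁿ⁺¹ ⟶ S`. -/
def Compatible {S : SSet.{v}} {n : ℕ} (x : ℕ → S _⦋n⦌) : Prop :=
  match n, x with
  | 0, _ => True
  | n + 1, x => ∀ i j, i ≤ j → j ≤ n + 1 → face i (x (j + 1)) = face j (x i)

lemma delta_comp_yoneda {S : SSet.{v}} {n : ℕ} (i : Fin (n + 2)) (x : S _⦋n + 1⦌) :
    SSet.stdSimplex.δ i ≫ SSet.yonedaEquiv.symm x = SSet.yonedaEquiv.symm (face i.val x) := by
  rw [face_val]
  exact SSet.stdSimplex.δ_comp_yonedaEquiv_symm _ _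

/-! ### Inner horns and replacement of a face -/

/-- A compatible family of faces of an inner horn in a quasicategory is filled. -/
lemma exists_filler_of_inner {C : SSet.{v}} [C.Quasicategory] {n l : ℕ} (h0 : 0 < l)
    (hl : l < n + 2) (x : ℕ → C _⦋n + 1⦌)
    (hx : ∀ i j, i ≤ j → j ≤ n + 1 → i ≠ l → j + 1 ≠ l → face i (x (j + 1)) = face j (x i)) :
    ∃ w : C _⦋n + 2⦌, ∀ i ≤ n + 2, i ≠ l → face i w = x i := by
  let l' : Fin (n + 3) := ⟨l, by omega⟩
  have hc : SSet.horn.IsCompatible (X := C) (n := n + 1) (i := l')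
      (fun j _ ↦ SSet.yonedaEquiv.symm (x j.val)) := by
    rw [SSet.horn.isCompatible_iff]
    intro j k hj hk hjk
    rw [delta_comp_yoneda, delta_comp_yoneda]
    congr 1
    obtain ⟨k, rfl⟩ := k.eq_succ_of_ne_zero (Fin.ne_zero_of_lt hjk)
    have h1 : j.val ≤ k.val := by simpa [Fin.lt_def, Nat.lt_succ_iff] using hjk
    have := hx j k h1 (by omega) (fun h ↦ hj (Fin.ext h)) (fun h ↦ hk (Fin.ext h))
    simpa using this.symm
  obtain ⟨φ, hφ⟩ := hc.exists_desc
  obtain ⟨g, hg⟩ := SSet.Quasicategory.hornFilling (S := C) (i := l')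
    (by simpa [Fin.lt_def, l'] using h0) (by simpa [Fin.lt_def, l'] using hl) φ
  refine ⟨SSet.yonedaEquiv g, fun i hi hil ↦ ?_⟩
  have h := hφ ⟨i, by omega⟩ (fun h ↦ hil (congrArg Fin.val h))
  rw [hg, SSet.horn.ι_ι_assoc] at h
  apply SSet.yonedaEquiv.symm.injective
  rw [← h]
  have := delta_comp_yoneda (S := C) (⟨i, by omega⟩ : Fin (n + 3)) (SSet.yonedaEquiv g)
  rw [Equiv.symm_apply_apply] at this
  exact this.symm

/-- The missing face of an inner horn filler. -/
lemma exists_missing_face {C : SSet.{v}} [C.Quasicategory] {n l : ℕ} (h0 : 0 < l)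
    (hl : l < n + 3) (x : ℕ → C _⦋n + 2⦌)
    (hx : ∀ i j, i ≤ j → j ≤ n + 2 → i ≠ l → j + 1 ≠ l → face i (x (j + 1)) = face j (x i)) :
    ∃ y : C _⦋n + 2⦌, (∀ i < l, face i y = face (l - 1) (x i)) ∧
      ∀ i, l ≤ i → i ≤ n + 2 → face i y = face l (x (i + 1)) := by
  obtain ⟨w, hw⟩ := exists_filler_of_inner h0 hl x hx
  obtain ⟨l, rfl⟩ := Nat.exists_eq_succ_of_ne_zero h0.ne'
  refine ⟨face (l + 1) w, fun i hi ↦ ?_, fun i hi hi' ↦ ?_⟩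
  · rw [face_face (by omega) (by omega), hw i (by omega) (by omega), Nat.succ_sub_one]
  · rw [← face_face (by omega) (by omega), hw (i + 1) (by omega) (by omega)]

/-- In a quasicategory, if two simplices `ξ` and `ξ'` differ at most in an inner face, then
that face of any simplex `θ` can be replaced accordingly. -/
lemma exists_replace_face {C : SSet.{v}} [C.Quasicategory] {n l : ℕ} (h0 : 0 < l)
    (hl : l < n + 2) (ξ ξ' θ : C _⦋n + 2⦌)
    (hξ : ∀ i ≤ n + 2, i ≠ l → face i ξ = face i ξ') (hθ : face l θ = face l ξ) :
    ∃ θ' : C _⦋n + 2⦌, face l θ' = face l ξ' ∧ ∀ i ≤ n + 2, i ≠ l → face i θ' = face i θ := by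
  obtain ⟨l, rfl⟩ := Nat.exists_eq_succ_of_ne_zero h0.ne'
  simp only [Nat.succ_eq_add_one] at *
  have hs (x : C _⦋n + 2⦌) : face (l + 1) (degen l x) = x := face_degen_succ (by omega) x
  -- Faces `l` and `l + 1` of `degen l ξ` are both `ξ`. Changing the second to `ξ'` and filling
  -- without face `l + 2` gives `H`, a homotopy relative to the boundary from `face (l + 1) ξ` to
  -- `face (l + 1) ξ'`.
  obtain ⟨H, hH1, hH2⟩ := exists_missing_face (C := C) (n := n) (l := l + 2) (by omega) (by omega)
    (fun i ↦ if i = l + 1 then ξ' else face i (degen l ξ)) (by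
      intro i j hij hj hi hj'
      split_ifs with h1 h2 h2
      · omega
      · obtain rfl : j = l := by omega
        rw [← face_face hij (by omega), hs, hξ i (by omega) h2]
      · subst h2
        rw [face_face hij (by omega), hs, hξ j hj (by omega)]
      · exact face_face hij (by omega) _)
  have hb : face (l + 1) H = face (l + 1) ξ' := by
    simpa using hH1 (l + 1) (by omega)
  have hH (i : ℕ) (hi : i ≤ n + 2) (hil : i ≠ l + 1) :
      face i H = face i (face (l + 2) (degen l θ)) := by
    have hθξ : face (l + 2) (degen l θ) = face (l + 2) (degen l ξ) := by
      rw [face_degen_of_gt (by omega) (by omega), face_degen_of_gt (by omega) (by omega), hθ]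
    rw [hθξ]
    rcases Nat.lt_or_ge i (l + 2) with h | h
    · rw [hH1 i h, if_neg hil, face_face (by omega) (by omega)]
      rfl
    · rw [hH2 i h hi, if_neg (by omega), face_face (by omega) (by omega)]
  -- The homotopy `H` is glued onto `θ`: it takes the place of face `l + 2` of `degen l θ`, and the
  -- missing face `l + 1` is the modified `θ`.
  obtain ⟨y, hy1, hy2⟩ := exists_missing_face (C := C) (n := n) (l := l + 1) (by omega) (by omega)
    (fun i ↦ if i = l + 2 then H else face i (degen l θ)) (by
      intro i j hij hj hi hj'
      split_ifs with h1 h2 h2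
      · omega
      · obtain rfl : j = l + 1 := by omega
        rw [hH i (by omega) hi, face_face hij (by omega)]
      · subst h2
        rw [hH j hj (by omega), face_face hij (by omega)]
      · exact face_face hij (by omega) _)
  refine ⟨y, ?_, fun i hi hil ↦ ?_⟩
  · rw [hy2 (l + 1) le_rfl (by omega), if_pos rfl, hb]
  · rcases Nat.lt_or_ge i (l + 1) with h | h
    · rw [hy1 i h, if_neg (by omega), Nat.add_sub_cancel, ← face_face (by omega) (by omega), hs]
    · rw [hy2 i h hi, if_neg (by omega), face_face (by omega) (by omega), hs]

/-! ### Maps out of boundaries -/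

/-- The boundary of a simplex is glued from its faces. -/
lemma boundary_multicoequalizerDiagram (n : ℕ) :
    SSet.Subcomplex.MulticoequalizerDiagram (SSet.boundary.{v} n)
      (fun j : Fin (n + 1) ↦ SSet.stdSimplex.face {j}ᶜ)
      (fun j k ↦ SSet.stdSimplex.face {j, k}ᶜ) where
  iSup_eq := by rw [SSet.boundary_eq_iSup]
  eq_inf j k := by
    rw [SSet.stdSimplex.face_inter_face]
    congr
    ext
    simp

lemma homOfLE_comp_faceSingletonComplIso_inv {S : SSet.{v}} {n : ℕ} {x : ℕ → S _⦋n⦌}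
    (hx : Compatible x) {a b : Fin (n + 2)} (hab : a < b)
    (ha : SSet.stdSimplex.face.{v} {a, b}ᶜ ≤ SSet.stdSimplex.face {a}ᶜ)
    (hb : SSet.stdSimplex.face.{v} {a, b}ᶜ ≤ SSet.stdSimplex.face {b}ᶜ) :
    SSet.Subcomplex.homOfLE ha ≫
        (SSet.stdSimplex.faceSingletonComplIso a).inv ≫ SSet.yonedaEquiv.symm (x a.val) =
      SSet.Subcomplex.homOfLE hb ≫
        (SSet.stdSimplex.faceSingletonComplIso b).inv ≫ SSet.yonedaEquiv.symm (x b.val) := by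
  obtain _ | n := n
  -- The two faces of `Δ¹` are disjoint, so there is nothing to compare.
  · rw [Fin.lt_def] at hab
    have h0 : a.val = 0 := by omega
    have h1 : b.val = 1 := by omega
    ext ⟨⟨d⟩⟩ ⟨y, hy⟩
    have hy' : y 0 ∈ ({a, b}ᶜ : Finset (Fin 2)) := (SSet.stdSimplex.mem_face_iff _ y).1 hy 0
    simp only [Finset.mem_compl, Finset.mem_insert, Finset.mem_singleton, Fin.ext_iff, h0, h1]
      at hy'
    omega
  · rw [SSet.stdSimplex.homOfLE_faceSingletonComplIso_inv_eq_facePairComplIso_inv_δ_pred_assoc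
        _ _ hab,
      SSet.stdSimplex.homOfLE_faceSingletonComplIso_inv_eq_facePairComplIso_inv_δ_castPred_assoc
        _ _ hab, delta_comp_yoneda, delta_comp_yoneda]
    congr 2
    obtain ⟨b, rfl⟩ := b.eq_succ_of_ne_zero (Fin.ne_zero_of_lt hab)
    have h1 : a.val ≤ b.val := by simpa [Fin.lt_def, Nat.lt_succ_iff] using hab
    simpa using (hx a.val b.val h1 (by omega)).symm

/-- The boundary is the colimit of its faces glued along pairwise intersections, which are the faces
of codimension two; agreement there is what `Compatible` records. -/
lemma exists_boundary_desc {S : SSet.{v}} {n : ℕ} (x : ℕ → S _⦋n⦌) (hx : Compatible x) :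
    ∃ f : (∂Δ[n + 1] : SSet.{v}) ⟶ S,
      ∀ i : Fin (n + 2), SSet.boundary.ι i ≫ f = SSet.yonedaEquiv.symm (x i.val) := by
  let c : Limits.Multicofork
      ((boundary_multicoequalizerDiagram.{v} (n + 1)).multispanIndex.toLinearOrder.map
        SSet.Subcomplex.toSSetFunctor) :=
    Limits.Multicofork.ofπ _ S
      (fun j ↦ (SSet.stdSimplex.faceSingletonComplIso j).inv ≫ SSet.yonedaEquiv.symm (x j.val))
      (fun ⟨_, hab⟩ ↦ homOfLE_comp_faceSingletonComplIso_inv hx hab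
        (by simp [SSet.stdSimplex.face_le_face_iff]) (by simp [SSet.stdSimplex.face_le_face_iff]))
  refine ⟨(boundary_multicoequalizerDiagram.{v} (n + 1)).isColimit'.desc c, fun j ↦ ?_⟩
  rw [← cancel_epi (SSet.stdSimplex.faceSingletonComplIso j).inv]
  exact (SSet.boundary.faceSingletonComplIso_inv_ι_assoc j _).trans
    ((boundary_multicoequalizerDiagram.{v} (n + 1)).isColimit'.fac c (.right j))

lemma boundary_ι_comp_ι_comp {S : SSet.{v}} {n : ℕ} (g : Δ[n + 1] ⟶ S) (i : Fin (n + 2)) :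
    SSet.boundary.ι i ≫ ∂Δ[n + 1].ι ≫ g =
      SSet.yonedaEquiv.symm (face i.val (SSet.yonedaEquiv g)) := by
  rw [SSet.boundary.ι_ι_assoc, ← delta_comp_yoneda, Equiv.symm_apply_apply]

/-! ### Spheres and cones at a final or initial vertex -/

/-- The last vertex of a simplex. -/
def lastVertex {S : SSet.{v}} {n : ℕ} (x : S _⦋n⦌) : S _⦋0⦌ :=
  S.map (SimplexCategory.const ⦋0⦌ ⦋n⦌ (Fin.last n)).op x

/-- The first vertex of a simplex. -/
def firstVertex {S : SSet.{v}} {n : ℕ} (x : S _⦋n⦌) : S _⦋0⦌ :=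
  S.map (SimplexCategory.const ⦋0⦌ ⦋n⦌ 0).op x

lemma lastVertex_face {S : SSet.{v}} {n i : ℕ} (hi : i ≤ n) (x : S _⦋n + 1⦌) :
    lastVertex (face i x) = lastVertex x := by
  rw [face_of_lt (show i < n + 2 by omega), lastVertex, lastVertex, SimplicialObject.δ,
    ← Functor.map_comp_apply, ← op_comp]
  congr 4
  ext j : 3
  change (Fin.succAbove ⟨i, by omega⟩ (Fin.last n)) = Fin.last (n + 1)
  rw [Fin.succAbove_of_le_castSucc _ _ (by simpa [Fin.le_def] using hi), Fin.succ_last]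

lemma firstVertex_face {S : SSet.{v}} {n i : ℕ} (hi : i ≤ n) (x : S _⦋n + 1⦌) :
    firstVertex (face (i + 1) x) = firstVertex x := by
  rw [face_of_lt (show i + 1 < n + 2 by omega), firstVertex, firstVertex, SimplicialObject.δ,
    ← Functor.map_comp_apply, ← op_comp]
  congr 3

lemma lastVertex_zero {S : SSet.{v}} (x : S _⦋0⦌) : lastVertex x = x := by
  simp [lastVertex]

lemma firstVertex_zero {S : SSet.{v}} (x : S _⦋0⦌) : firstVertex x = x := by
  rw [firstVertex, SimplexCategory.const_eq_id]
  simp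

lemma face_one_eq_firstVertex {S : SSet.{v}} (x : S _⦋1⦌) : face 1 x = firstVertex x :=
  (firstVertex_zero _).symm.trans (firstVertex_face (i := 0) le_rfl x)

/-- The zeroth face contains the last vertex of the sphere, so finality can be tested on `x 0`
alone. -/
lemma IsFinal.exists_filler {S : SSet.{v}} {p : S _⦋0⦌} (hp : IsFinal p) {n : ℕ}
    (x : ℕ → S _⦋n⦌) (hx : Compatible x) (hl : lastVertex (x 0) = p) :
    ∃ w : S _⦋n + 1⦌, ∀ i ≤ n + 1, face i w = x i := by
  obtain ⟨f, hf⟩ := exists_boundary_desc x hx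
  obtain ⟨g, hg⟩ := hp n f (by
    rw [← hl, lastVertex]
    have h := hf 0
    have : boundaryVertex n (Fin.last (n + 1)) = (SSet.boundary.ι (0 : Fin (n + 2))).app (op ⦋0⦌)
        (SSet.stdSimplex.obj₀Equiv.symm (Fin.last n)) := by
      apply Subtype.ext
      apply SSet.stdSimplex.obj₀Equiv.injective
      rfl
    rw [this, ← ConcreteCategory.comp_apply, ← NatTrans.comp_app, h]
    rfl)
  refine ⟨SSet.yonedaEquiv g, fun i hi ↦ SSet.yonedaEquiv.symm.injective ?_⟩
  have := boundary_ι_comp_ι_comp g ⟨i, by omega⟩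
  rw [hg, hf] at this
  exact this.symm

lemma IsInitial.exists_filler {S : SSet.{v}} {p : S _⦋0⦌} (hp : IsInitial p) {n : ℕ}
    (x : ℕ → S _⦋n⦌) (hx : Compatible x) (hl : firstVertex (x (n + 1)) = p) :
    ∃ w : S _⦋n + 1⦌, ∀ i ≤ n + 1, face i w = x i := by
  obtain ⟨f, hf⟩ := exists_boundary_desc x hx
  obtain ⟨g, hg⟩ := hp n f (by
    rw [← hl, firstVertex]
    have h := hf (Fin.last (n + 1))
    have : boundaryVertex n 0 = (SSet.boundary.ι (Fin.last (n + 1))).app (op ⦋0⦌)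
        (SSet.stdSimplex.obj₀Equiv.symm 0) := by
      apply Subtype.ext
      apply SSet.stdSimplex.obj₀Equiv.injective
      rfl
    rw [this, ← ConcreteCategory.comp_apply, ← NatTrans.comp_app, h]
    rfl)
  refine ⟨SSet.yonedaEquiv g, fun i hi ↦ SSet.yonedaEquiv.symm.injective ?_⟩
  have := boundary_ι_comp_ι_comp g ⟨i, by omega⟩
  rw [hg, hf] at this
  exact this.symm

/-- Every simplex of a simplicial set with a final object is, compatibly with faces, the base of
a cone with that object as its tip. -/
lemma IsFinal.exists_cone {S : SSet.{v}} {p : S _⦋0⦌} (hp : IsFinal p) :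
    ∃ κ : ∀ n, S _⦋n⦌ → S _⦋n + 1⦌, (∀ s, face 0 (κ 0 s) = p) ∧
      (∀ n s, face (n + 1) (κ n s) = s) ∧
      ∀ n s, ∀ i ≤ n + 1, face i (κ (n + 1) s) = κ n (face i s) := by
  classical
  have base (s : S _⦋0⦌) : ∃ w : S _⦋1⦌, face 0 w = p ∧ face 1 w = s := by
    obtain ⟨w, hw⟩ := hp.exists_filler (fun i ↦ if i = 0 then p else s) trivial
      (by simp [lastVertex_zero])
    exact ⟨w, by simpa using hw 0, by simpa using hw 1⟩
  choose κ₀ h₀ h₁ using base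
  let R (n : ℕ) (k : S _⦋n⦌ → S _⦋n + 1⦌) (s : S _⦋n + 1⦌) (w : S _⦋n + 2⦌) : Prop :=
    face (n + 2) w = s ∧ ∀ i ≤ n + 1, face i w = k (face i s)
  obtain ⟨κ, rfl, step⟩ : ∃ κ : ∀ n, S _⦋n⦌ → S _⦋n + 1⦌, κ 0 = κ₀ ∧
      ∀ n s, (∃ w, R n (κ n) s w) → R n (κ n) s (κ (n + 1) s) := by
    -- A filler exists only if the previous stage is good, so the recursion is total with the junk
    -- value `degen 0 s`; `main` shows that this value never occurs.
    refine ⟨fun n ↦ Nat.rec κ₀ (fun n k s ↦ if h : ∃ w, R n k s w then h.choose else degen 0 s) n,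
      rfl, fun n s h ↦ ?_⟩
    simp only [dif_pos h]
    exact h.choose_spec
  have main (n : ℕ) : (∀ s, face (n + 1) (κ n s) = s) ∧ (∀ s, lastVertex (κ n s) = p) ∧
      ∀ s, R n (κ n) s (κ (n + 1) s) := by
    induction n with
    | zero =>
      have hl (s : S _⦋0⦌) : lastVertex (κ 0 s) = p := by
        rw [← lastVertex_face (i := 0) le_rfl, lastVertex_zero]
        exact h₀ s
      refine ⟨h₁, hl, fun s ↦ step 0 s ?_⟩
      obtain ⟨w, hw⟩ := hp.exists_filler (n := 1) (fun i ↦ if i ≤ 1 then κ 0 (face i s) else s) (by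
        intro i j hij hj
        have hj : j ≤ 1 := hj
        have hi : i ≤ 1 := by omega
        obtain rfl | rfl : j = 0 ∨ j = 1 := by omega
        · obtain rfl : i = 0 := by omega
          simp [h₀]
        · simpa [hi] using (h₁ (face i s)).symm) (by simpa using hl _)
      exact ⟨w, by simpa using hw 2 le_rfl, fun i hi ↦ by simpa [hi] using hw i (by omega)⟩
    | succ n ih =>
      obtain ⟨ih1, ih2, ih3⟩ := ih
      have hl (s : S _⦋n + 1⦌) : lastVertex (κ (n + 1) s) = p := by
        rw [← lastVertex_face (i := 0) (by omega), (ih3 s).2 0 (by omega), ih2]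
      refine ⟨fun s ↦ (ih3 s).1, hl, fun s ↦ step (n + 1) s ?_⟩
      obtain ⟨w, hw⟩ := hp.exists_filler
        (fun i ↦ if i ≤ n + 2 then κ (n + 1) (face i s) else s) (by
        intro i j hij hj
        have hi : i ≤ n + 2 := by omega
        rcases Nat.lt_or_ge j (n + 2) with h | h
        · have hj' : j + 1 ≤ n + 2 := by omega
          simp only [hi, hj', if_true]
          rw [(ih3 _).2 i (by omega), (ih3 _).2 j (by omega), face_face hij (by omega)]
        · obtain rfl : j = n + 2 := by omega
          simpa [hi] using ((ih3 (face i s)).1).symm) (by simpa using hl _)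
      refine ⟨w, by simpa using hw (n + 3) le_rfl, fun i hi ↦ ?_⟩
      have := hw i (by omega)
      rwa [if_pos (by omega)] at this
  exact ⟨κ, h₀, fun n ↦ (main n).1, fun n s ↦ ((main n).2.2 s).2⟩

/-- Every simplex of a simplicial set with an initial object is, compatibly with faces, the base
of a cocone with that object as its tip. -/
lemma IsInitial.exists_cocone {S : SSet.{v}} {p : S _⦋0⦌} (hp : IsInitial p) :
    ∃ κ : ∀ n, S _⦋n⦌ → S _⦋n + 1⦌, (∀ s, face 1 (κ 0 s) = p) ∧
      (∀ n s, face 0 (κ n s) = s) ∧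
      ∀ n s, ∀ i ≤ n + 1, face (i + 1) (κ (n + 1) s) = κ n (face i s) := by
  classical
  have base (s : S _⦋0⦌) : ∃ w : S _⦋1⦌, face 1 w = p ∧ face 0 w = s := by
    obtain ⟨w, hw⟩ := hp.exists_filler (fun i ↦ if i = 0 then s else p) trivial
      (by simp [firstVertex_zero])
    exact ⟨w, by simpa using hw 1, by simpa using hw 0⟩
  choose κ₀ h₁ h₀ using base
  let R (n : ℕ) (k : S _⦋n⦌ → S _⦋n + 1⦌) (s : S _⦋n + 1⦌) (w : S _⦋n + 2⦌) : Prop :=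
    face 0 w = s ∧ ∀ i ≤ n + 1, face (i + 1) w = k (face i s)
  obtain ⟨κ, rfl, step⟩ : ∃ κ : ∀ n, S _⦋n⦌ → S _⦋n + 1⦌, κ 0 = κ₀ ∧
      ∀ n s, (∃ w, R n (κ n) s w) → R n (κ n) s (κ (n + 1) s) := by
    refine ⟨fun n ↦ Nat.rec κ₀ (fun n k s ↦ if h : ∃ w, R n k s w then h.choose else degen 0 s) n,
      rfl, fun n s h ↦ ?_⟩
    simp only [dif_pos h]
    exact h.choose_spec
  have main (n : ℕ) : (∀ s, face 0 (κ n s) = s) ∧ (∀ s, firstVertex (κ n s) = p) ∧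
      ∀ s, R n (κ n) s (κ (n + 1) s) := by
    induction n with
    | zero =>
      have hl (s : S _⦋0⦌) : firstVertex (κ 0 s) = p := by
        rw [← firstVertex_face (i := 0) le_rfl, firstVertex_zero]
        exact h₁ s
      refine ⟨h₀, hl, fun s ↦ step 0 s ?_⟩
      obtain ⟨w, hw⟩ := hp.exists_filler (n := 1) (fun i ↦ if i = 0 then s else κ 0 (face (i - 1) s)) (by
        intro i j hij hj
        have hj : j ≤ 1 := hj
        obtain rfl | rfl : i = 0 ∨ i = 1 := by omega
        · simpa using h₀ (face j s)
        · obtain rfl : j = 1 := by omega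
          simp [h₁]) (by simpa using hl _)
      exact ⟨w, by simpa using hw 0 (by omega), fun i hi ↦ by simpa using hw (i + 1) (by omega)⟩
    | succ n ih =>
      obtain ⟨ih1, ih2, ih3⟩ := ih
      have hl (s : S _⦋n + 1⦌) : firstVertex (κ (n + 1) s) = p := by
        rw [← firstVertex_face (i := 0) (by omega), (ih3 s).2 0 (by omega), ih2]
      refine ⟨fun s ↦ (ih3 s).1, hl, fun s ↦ step (n + 1) s ?_⟩
      obtain ⟨w, hw⟩ := hp.exists_filler
        (fun i ↦ if i = 0 then s else κ (n + 1) (face (i - 1) s)) (by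
        intro i j hij hj
        obtain _ | i := i
        · simpa using (ih3 (face j s)).1
        · obtain ⟨j, rfl⟩ : ∃ k, j = k + 1 := ⟨j - 1, by omega⟩
          simp only [Nat.add_eq_zero_iff, one_ne_zero, and_false, if_false, Nat.add_sub_cancel]
          rw [(ih3 _).2 i (by omega), (ih3 _).2 j (by omega), face_face (by omega) (by omega)])
        (by simpa using hl _)
      exact ⟨w, by simpa using hw 0 (by omega), fun i hi ↦ by simpa using hw (i + 1) (by omega)⟩
  exact ⟨κ, h₁, fun n ↦ (main n).1, fun n s ↦ ((main n).2.2 s).2⟩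

/-! ### Slices over and under constant discrete diagrams -/

/-- The two inclusions cover the ordinal sum. This formula reduces identities between joins of maps
to arithmetic. -/
lemma tensorHomOf_val {m m' n n' : SimplexCategory} (f : m ⟶ m') (g : n ⟶ n')
    (i : Fin (m.len + n.len + 1 + 1)) :
    ((tensorHomOf f g).toOrderHom i).val =
      if h : i.val < m.len + 1 then (f.toOrderHom ⟨i.val, h⟩).val
      else m'.len + 1 + (g.toOrderHom ⟨i.val - (m.len + 1), by omega⟩).val := by
  split_ifs with h
  · have h1 := congrArg (fun k ↦ (k.toOrderHom ⟨i.val, h⟩).val) (inl_comp f g)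
    simp only [SimplexCategory.comp_toOrderHom, OrderHom.comp_coe, Function.comp_apply] at h1
    rw [inl'_eval, inl'_eval] at h1
    simpa using h1
  · have h1 := congrArg (fun k ↦ (k.toOrderHom ⟨i.val - (m.len + 1), by omega⟩).val)
      (inr_comp f g)
    simp only [SimplexCategory.comp_toOrderHom, OrderHom.comp_coe, Function.comp_apply] at h1
    rw [inr'_eval, inr'_eval] at h1
    simp at h1
    rw [← h1]
    congr 3
    ext
    simp
    omega

/-- The identification of `[n + 1]` with `[0] ⋆ [n]`. -/
def consIso (n : ℕ) : ⦋n + 1⦌ ≅ tensorObjOf ⦋0⦌ ⦋n⦌ :=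
  eqToIso (by
    change ⦋n + 1⦌ = ⦋0 + n + 1⦌
    rw [Nat.zero_add])

lemma consIso_hom_val (n : ℕ) (i : Fin (n + 2)) : ((consIso n).hom.toOrderHom i).val = i.val := by
  simp [consIso, SimplexCategory.eqToHom_toOrderHom]

lemma delta_val {n : ℕ} (i : Fin (n + 2)) (j : Fin (n + 1)) :
    ((SimplexCategory.δ i).toOrderHom j).val = if j.val < i.val then j.val else j.val + 1 := by
  change (Fin.succAbove i j).val = _
  simp only [Fin.succAbove, Fin.lt_def]
  split_ifs <;> simp_all

/-- Here `n + 0 + 1` reduces to `n + 1`, so slices over a diagram need no transport; `0 + n + 1`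
does not, so slices under a diagram go through `consIso`. -/
lemma inl'_zero_right (n : ℕ) : inl' ⦋n⦌ ⦋0⦌ = SimplexCategory.δ (Fin.last (n + 1)) := by
  ext i : 3
  apply Fin.ext
  rw [inl'_eval]
  refine Eq.trans ?_ (delta_val (Fin.last (n + 1)) i).symm
  have : i.val < n + 1 := i.isLt
  simp [this]

lemma inr'_zero_right (n : ℕ) :
    inr' ⦋n⦌ ⦋0⦌ = SimplexCategory.const ⦋0⦌ ⦋n + 1⦌ (Fin.last (n + 1)) := by
  ext i : 3
  apply Fin.ext
  rw [inr'_eval]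
  have : i.val < 1 := i.isLt
  change n + 1 + i.val = n + 1
  omega

lemma tensorHomOf_delta_id (n : ℕ) (i : Fin (n + 2)) :
    tensorHomOf (SimplexCategory.δ i) (𝟙 ⦋0⦌) = SimplexCategory.δ i.castSucc := by
  ext j : 3
  apply Fin.ext
  rw [tensorHomOf_val]
  refine Eq.trans ?_ (delta_val (n := n + 1) i.castSucc j).symm
  have hj : j.val < n + 2 := j.isLt
  have hi := i.isLt
  split_ifs with h h' h'
  · rw [delta_val, if_pos (by simpa using h')]
  · rw [delta_val, if_neg (by simpa using h')]
  · simp at h h'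
    omega
  · simp at h ⊢
    omega

lemma inr'_zero_left (n : ℕ) :
    inr' ⦋0⦌ ⦋n⦌ = SimplexCategory.δ 0 ≫ (consIso n).hom := by
  ext i : 3
  apply Fin.ext
  rw [inr'_eval]
  refine Eq.trans ?_ (consIso_hom_val n _).symm
  refine Eq.trans ?_ (delta_val 0 i).symm
  simp [Nat.add_comm]

lemma inl'_zero_left (n : ℕ) :
    inl' ⦋0⦌ ⦋n⦌ = SimplexCategory.const ⦋0⦌ ⦋n + 1⦌ 0 ≫ (consIso n).hom := by
  ext i : 3
  apply Fin.ext
  rw [inl'_eval]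
  refine Eq.trans ?_ (consIso_hom_val n _).symm
  have : i.val < 1 := i.isLt
  change i.val = 0
  omega

lemma consIso_hom_comp_tensorHomOf (n : ℕ) (i : Fin (n + 2)) :
    (consIso n).hom ≫ tensorHomOf (𝟙 ⦋0⦌) (SimplexCategory.δ i) =
      SimplexCategory.δ i.succ ≫ (consIso (n + 1)).hom := by
  ext j : 3
  apply Fin.ext
  refine Eq.trans ?_ (consIso_hom_val (n + 1) _).symm
  refine Eq.trans (tensorHomOf_val _ _ _) ?_
  refine Eq.trans ?_ (delta_val (n := n + 1) i.succ j).symm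
  have hj : j.val < n + 2 := j.isLt
  have hi := i.isLt
  have hc := consIso_hom_val n j
  split_ifs with h h' h'
  · exact hc
  · change ((consIso n).hom.toOrderHom j).val < 1 at h
    simp at h'
    omega
  · change ¬ ((consIso n).hom.toOrderHom j).val < 1 at h
    rw [delta_val]
    change 1 + (if ((consIso n).hom.toOrderHom j).val - 1 < i.val then _ else _) = _
    rw [Fin.val_succ] at h'
    rw [if_pos (by omega)]
    change 1 + (((consIso n).hom.toOrderHom j).val - 1) = _
    omega
  · change ¬ ((consIso n).hom.toOrderHom j).val < 1 at h
    rw [delta_val]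
    change 1 + (if ((consIso n).hom.toOrderHom j).val - 1 < i.val then _ else _) = _
    rw [Fin.val_succ] at h'
    rw [if_neg (by omega)]
    change 1 + (((consIso n).hom.toOrderHom j).val - 1 + 1) = _
    omega

/-- The discrete simplicial set on a type. -/
def discrete (I : Type v) : SSet.{v} := (Functor.const _).obj I

lemma isSmall_discrete (I : Type v) [Small.{w} I] : IsSmall.{v, w} (discrete I) :=
  fun _ ↦ inferInstanceAs (Small.{w} I)

section Over

variable {C : SSet.{v}} {I : Type v} {Y : C _⦋0⦌}

/-- The cell of a simplex of a slice over a discrete diagram at a point of the diagram. -/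
def overCell {n : ℕ} (s : (overSlice (K := discrete I) (SSet.const Y)) _⦋n⦌) (i : I) :
    C _⦋n + 1⦌ :=
  OverSimplex.cell (n := ⦋n⦌) s ⦋0⦌ i

lemma overCell_face {n : ℕ} (s : (overSlice (K := discrete I) (SSet.const Y)) _⦋n + 1⦌) {j : ℕ}
    (hj : j ≤ n + 1) (i : I) : overCell (face j s) i = face j (overCell s i) := by
  rw [face_of_lt (show j < n + 2 by omega), face_of_lt (show j < n + 3 by omega)]
  exact congrArg (fun f ↦ C.map f.op (OverSimplex.cell (n := ⦋n + 1⦌) s ⦋0⦌ i))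
    (tensorHomOf_delta_id n ⟨j, by omega⟩)

/-- The base of a simplex of a slice over a diagram. -/
def overVert {n : ℕ} (s : (overSlice (K := discrete I) (SSet.const Y)) _⦋n⦌) : C _⦋n⦌ :=
  OverSimplex.vert (n := ⦋n⦌) s

lemma overVert_face {n : ℕ} (s : (overSlice (K := discrete I) (SSet.const Y)) _⦋n + 1⦌) (j : ℕ) :
    overVert (face j s) = face j (overVert s) := rfl

lemma face_overCell {n : ℕ} (s : (overSlice (K := discrete I) (SSet.const Y)) _⦋n⦌) (i : I) :
    face (n + 1) (overCell s i) = overVert s := by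
  rw [face_of_lt (show n + 1 < n + 2 by omega), overVert,
    ← OverSimplex.cell_left (n := ⦋n⦌) s ⦋0⦌ i, inl'_zero_right]
  rfl

/-- Every simplex of a discrete simplicial set is a degeneracy of a vertex, so naturality along `[j]
⟶ [0]` determines all cells from those at vertices. -/
lemma over_ext {n : ℕ} {s t : (overSlice (K := discrete I) (SSet.const Y)) _⦋n⦌}
    (h : overVert s = overVert t) (h' : ∀ i, overCell s i = overCell t i) : s = t := by
  refine OverSimplex.ext h ?_
  funext j k
  exact (OverSimplex.cell_natural s ⦋0⦌ j (SimplexCategory.const _ _ 0) k).trans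
    ((congrArg _ (h' k)).trans
      (OverSimplex.cell_natural t ⦋0⦌ j (SimplexCategory.const _ _ 0) k).symm)

lemma exists_over {n : ℕ} (x : C _⦋n⦌) (c : I → C _⦋n + 1⦌) (hc : ∀ i, face (n + 1) (c i) = x)
    (hY : ∀ i, lastVertex (c i) = Y) :
    ∃ s : (overSlice (K := discrete I) (SSet.const Y)) _⦋n⦌,
      overVert s = x ∧ ∀ i, overCell s i = c i := by
  refine ⟨⟨x, fun j k ↦ C.map (tensorHomOf (𝟙 ⦋n⦌) (SimplexCategory.const j ⦋0⦌ 0)).op (c k),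
    fun j j' g k ↦ ?_, fun j k ↦ ?_, fun j k ↦ ?_⟩, rfl, fun i ↦ ?_⟩
  · rw [← Functor.map_comp_apply, ← op_comp, sum_comp, Category.id_comp]
    rfl
  · rw [← Functor.map_comp_apply, ← op_comp, inl_comp, Category.id_comp, inl'_zero_right, ← hc k,
      face_of_lt (show n + 1 < n + 2 by omega)]
    rfl
  · rw [← Functor.map_comp_apply, ← op_comp, inr_comp, inr'_zero_right, op_comp,
      Functor.map_comp_apply]
    exact congrArg (C.map (SimplexCategory.const j ⦋0⦌ 0).op) (hY k)
  · change C.map (tensorHomOf (𝟙 ⦋n⦌) (SimplexCategory.const ⦋0⦌ ⦋0⦌ 0)).op (c i) = c i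
    rw [SimplexCategory.const_eq_id, sum_id]
    simp

end Over

section Under

variable {C : SSet.{v}} {I : Type v} {X : C _⦋0⦌}

/-- The cell of a simplex of a slice under a discrete diagram at a point of the diagram. -/
def underCell {n : ℕ} (s : (underSlice (K := discrete I) (SSet.const X)) _⦋n⦌) (i : I) :
    C _⦋n + 1⦌ :=
  C.map (consIso n).hom.op (UnderSimplex.cell (n := ⦋n⦌) s ⦋0⦌ i)

lemma underCell_face {n : ℕ} (s : (underSlice (K := discrete I) (SSet.const X)) _⦋n + 1⦌) {j : ℕ}
    (hj : j ≤ n + 1) (i : I) : underCell (face j s) i = face (j + 1) (underCell s i) := by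
  rw [face_of_lt (show j < n + 2 by omega), face_of_lt (show j + 1 < n + 3 by omega)]
  change C.map _ (C.map _ _) = C.map _ (C.map _ _)
  rw [← Functor.map_comp_apply, ← Functor.map_comp_apply, ← op_comp, ← op_comp]
  exact congrArg (fun f ↦ C.map f.op (UnderSimplex.cell (n := ⦋n + 1⦌) s ⦋0⦌ i))
    (consIso_hom_comp_tensorHomOf n ⟨j, by omega⟩)

/-- The base of a simplex of a slice under a diagram. -/
def underVert {n : ℕ} (s : (underSlice (K := discrete I) (SSet.const X)) _⦋n⦌) : C _⦋n⦌ :=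
  UnderSimplex.vert (n := ⦋n⦌) s

lemma underVert_face {n : ℕ} (s : (underSlice (K := discrete I) (SSet.const X)) _⦋n + 1⦌)
    (j : ℕ) : underVert (face j s) = face j (underVert s) := rfl

lemma face_underCell {n : ℕ} (s : (underSlice (K := discrete I) (SSet.const X)) _⦋n⦌) (i : I) :
    face 0 (underCell s i) = underVert s := by
  rw [face_of_lt (show 0 < n + 2 by omega), underVert,
    ← UnderSimplex.cell_right (n := ⦋n⦌) s ⦋0⦌ i, inr'_zero_left, op_comp,
    Functor.map_comp_apply]
  rfl

lemma under_ext {n : ℕ} {s t : (underSlice (K := discrete I) (SSet.const X)) _⦋n⦌}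
    (h : underVert s = underVert t) (h' : ∀ i, underCell s i = underCell t i) : s = t := by
  refine UnderSimplex.ext h ?_
  have h'' (i : I) : UnderSimplex.cell (n := ⦋n⦌) s ⦋0⦌ i = UnderSimplex.cell (n := ⦋n⦌) t ⦋0⦌ i := by
    have := congrArg (C.map (consIso n).inv.op) (h' i)
    simpa [underCell, ← Functor.map_comp_apply, ← op_comp] using this
  funext j k
  exact (UnderSimplex.cell_natural s ⦋0⦌ j (SimplexCategory.const _ _ 0) k).trans
    ((congrArg _ (h'' k)).trans
      (UnderSimplex.cell_natural t ⦋0⦌ j (SimplexCategory.const _ _ 0) k).symm)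

lemma exists_under {n : ℕ} (x : C _⦋n⦌) (c : I → C _⦋n + 1⦌) (hc : ∀ i, face 0 (c i) = x)
    (hX : ∀ i, firstVertex (c i) = X) :
    ∃ s : (underSlice (K := discrete I) (SSet.const X)) _⦋n⦌,
      underVert s = x ∧ ∀ i, underCell s i = c i := by
  refine ⟨⟨x, fun j k ↦ C.map (tensorHomOf (SimplexCategory.const j ⦋0⦌ 0) (𝟙 ⦋n⦌)).op
    (C.map (consIso n).inv.op (c k)), fun j j' g k ↦ ?_, fun j k ↦ ?_, fun j k ↦ ?_⟩, rfl,
    fun i ↦ ?_⟩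
  · change C.map _ (C.map (consIso n).inv.op (c k)) =
      C.map _ (C.map _ (C.map (consIso n).inv.op (c k)))
    generalize C.map (consIso n).inv.op (c k) = z
    rw [← Functor.map_comp_apply, ← op_comp, sum_comp, Category.id_comp]
    rfl
  · rw [← Functor.map_comp_apply, ← Functor.map_comp_apply, ← op_comp, ← op_comp, Category.assoc,
      ← Category.assoc, inl_comp, inl'_zero_left, Category.assoc, Category.assoc,
      Iso.hom_inv_id, Category.comp_id, op_comp, Functor.map_comp_apply]
    exact congrArg (C.map (SimplexCategory.const j ⦋0⦌ 0).op) (hX k)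
  · rw [← Functor.map_comp_apply, ← Functor.map_comp_apply, ← op_comp, ← op_comp, Category.assoc,
      ← Category.assoc, inr_comp, Category.id_comp, inr'_zero_left, Category.assoc,
      Iso.hom_inv_id, Category.comp_id, ← hc k, face_of_lt (show 0 < n + 2 by omega)]
    rfl
  · change C.map _ (C.map (tensorHomOf (SimplexCategory.const ⦋0⦌ ⦋0⦌ 0) (𝟙 ⦋n⦌)).op _) = c i
    rw [SimplexCategory.const_eq_id, sum_id]
    simp [← Functor.map_comp_apply, ← op_comp]

end Under

/-! ### Comparison simplices from powers and copowers -/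

/-- Limits of constant discrete diagrams produce, for two `(n + 1)`-simplices `a`, `b` with the
same boundary and every subset `A` of `I`, simplices indexed by `I` with common last face,
whose last but one face is `a` or `b` depending on membership in `A`. -/
lemma HasSmallLimits.exists_comparison {C : SSet.{v}} (hC : HasSmallLimits.{v, w} C) (I : Type v)
    [Small.{w} I] {n : ℕ} (a b : C _⦋n + 1⦌) (hab : ∀ i ≤ n + 1, face i a = face i b) :
    ∃ (ξ : Set I → I → C _⦋n + 2⦌) (t : Set I → C _⦋n + 1⦌),
      (∀ A i, face (n + 2) (ξ A i) = t A) ∧ (∀ A, ∀ i ∈ A, face (n + 1) (ξ A i) = a) ∧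
      (∀ A, ∀ i ∉ A, face (n + 1) (ξ A i) = b) ∧
      ∀ A B i, ∀ j ≤ n, face j (ξ A i) = face j (ξ B i) := by
  classical
  obtain ⟨p, hp⟩ := hC (discrete I) (isSmall_discrete I) (SSet.const (lastVertex a))
  obtain ⟨κ, hκ0, hκs, hκ⟩ := hp.exists_cone
  have hlast : lastVertex b = lastVertex a := by
    rw [← lastVertex_face (i := 0) (by omega), ← hab 0 (by omega), lastVertex_face (by omega)]
  -- The subset `A` is encoded in a simplex `s A` of the slice; its faces do not depend on `A`,
  -- because `a` and `b` have the same boundary.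
  have ex (A : Set I) := exists_over (Y := lastVertex a) (face (n + 1) a)
    (fun i ↦ if i ∈ A then a else b) (by intro i; split_ifs <;> simp [hab])
    (by intro i; split_ifs <;> simp [hlast])
  choose s hs1 hs2 using ex
  refine ⟨fun A i ↦ overCell (κ n (s A)) i, fun A ↦ overVert (κ n (s A)),
    fun A i ↦ face_overCell _ _, fun A i hi ↦ ?_, fun A i hi ↦ ?_, fun A B i j hj ↦ ?_⟩
  · rw [← overCell_face _ le_rfl, hκs, hs2, if_pos hi]
  · rw [← overCell_face _ le_rfl, hκs, hs2, if_neg hi]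
  · rw [← overCell_face _ (by omega), ← overCell_face _ (by omega)]
    congr 1
    -- If `s A` is a vertex, the remaining face of its cone is the tip `p`. Otherwise it is the cone
    -- on a face of `s A`. Neither depends on `A`.
    obtain _ | n := n
    · obtain rfl : j = 0 := by omega
      rw [hκ0, hκ0]
    · rw [hκ n _ j hj, hκ n _ j hj]
      congr 1
      apply over_ext
      · rw [overVert_face, overVert_face, hs1, hs1]
      · intro i
        rw [overCell_face _ hj, overCell_face _ hj, hs2, hs2]
        split_ifs <;> simp [hab j (by omega)]

/-- Colimits of constant discrete diagrams produce, for two `(n + 1)`-simplices `a`, `b` with the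
same boundary and every subset `A` of `I`, simplices indexed by `I` with common zeroth face,
whose first face is `a` or `b` depending on membership in `A`. -/
lemma HasSmallColimits.exists_comparison {C : SSet.{v}} (hC : HasSmallColimits.{v, w} C)
    (I : Type v) [Small.{w} I] {n : ℕ} (a b : C _⦋n + 1⦌)
    (hab : ∀ i ≤ n + 1, face i a = face i b) :
    ∃ (ξ : Set I → I → C _⦋n + 2⦌) (t : Set I → C _⦋n + 1⦌),
      (∀ A i, face 0 (ξ A i) = t A) ∧ (∀ A, ∀ i ∈ A, face 1 (ξ A i) = a) ∧
      (∀ A, ∀ i ∉ A, face 1 (ξ A i) = b) ∧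
      ∀ A B i, ∀ j, 1 ≤ j → j ≤ n + 1 → face (j + 1) (ξ A i) = face (j + 1) (ξ B i) := by
  classical
  obtain ⟨p, hp⟩ := hC (discrete I) (isSmall_discrete I) (SSet.const (firstVertex a))
  obtain ⟨κ, hκ0, hκs, hκ⟩ := hp.exists_cocone
  have hfirst : firstVertex b = firstVertex a := by
    rw [← firstVertex_face (i := 0) (by omega), ← hab _ (by omega), firstVertex_face (by omega)]
  have ex (A : Set I) := exists_under (X := firstVertex a) (face 0 a)
    (fun i ↦ if i ∈ A then a else b) (by intro i; split_ifs <;> simp [hab])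
    (by intro i; split_ifs <;> simp [hfirst])
  choose s hs1 hs2 using ex
  refine ⟨fun A i ↦ underCell (κ n (s A)) i, fun A ↦ underVert (κ n (s A)),
    fun A i ↦ face_underCell _ _, fun A i hi ↦ ?_, fun A i hi ↦ ?_, fun A B i j hj1 hj ↦ ?_⟩
  · rw [← underCell_face _ (by omega), hκs, hs2, if_pos hi]
  · rw [← underCell_face _ (by omega), hκs, hs2, if_neg hi]
  · rw [← underCell_face _ hj, ← underCell_face _ hj]
    congr 1
    obtain ⟨j, rfl⟩ : ∃ k, j = k + 1 := ⟨j - 1, by omega⟩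
    obtain _ | n := n
    · obtain rfl : j = 0 := by omega
      rw [hκ0, hκ0]
    · rw [hκ n _ j (by omega), hκ n _ j (by omega)]
      congr 1
      apply under_ext
      · rw [underVert_face, underVert_face, hs1, hs1]
      · intro i
        rw [underCell_face _ (by omega), underCell_face _ (by omega), hs2, hs2]
        split_ifs <;> simp [hab (j + 1) (by omega)]

/-! ### Transport of fillers along natural equivalences -/

/-- The simplex of the walking isomorphism with given sequence of vertices. -/
def isoSimplex (n : ℕ) (q : ℕ → Bool) : SSet.coherentIso.{v} _⦋n⦌ :=
  Codiscrete.equivFun.symm fun k ↦ ULift.up (q k.val)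

/-- Precomposition with the injection omitting `i`. -/
def omitAt (i : ℕ) (q : ℕ → Bool) : ℕ → Bool := fun j ↦ q (if j < i then j else j + 1)

lemma face_isoSimplex {n i : ℕ} (hi : i ≤ n + 1) (q : ℕ → Bool) :
    face i (isoSimplex (n + 1) q) = isoSimplex.{v} n (omitAt i q) := by
  rw [face_of_lt (show i < n + 2 by omega)]
  apply Codiscrete.equivFun.injective
  funext k
  change ULift.up (q (Fin.succAbove ⟨i, by omega⟩ k).val) = ULift.up _
  simp only [omitAt, Fin.succAbove, Fin.lt_def]
  split_ifs <;> simp_all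

lemma omitAt_omitAt {i j : ℕ} (hij : i ≤ j) (q : ℕ → Bool) :
    omitAt i (omitAt (j + 1) q) = omitAt j (omitAt i q) := by
  funext m
  simp only [omitAt]
  congr 1
  split_ifs <;> omega

lemma isoSimplex_congr {n : ℕ} {q r : ℕ → Bool} (h : ∀ i ≤ n, q i = r i) :
    isoSimplex.{v} n q = isoSimplex n r := by
  apply Codiscrete.equivFun.injective
  funext k
  exact congrArg ULift.up (h k.val (by omega))

section

variable {C D : SSet.{v}} (h : C ⊗ SSet.coherentIso.{v} ⟶ D)

/-- The value of a homotopy at a simplex along a sequence of vertices of the walking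
isomorphism. -/
def homotopySimplex {n : ℕ} (x : C _⦋n⦌) (q : ℕ → Bool) : D _⦋n⦌ :=
  h.app (op ⦋n⦌) (x, isoSimplex n q)

lemma face_homotopySimplex {n i : ℕ} (hi : i ≤ n + 1) (x : C _⦋n + 1⦌) (q : ℕ → Bool) :
    face i (homotopySimplex h x q) = homotopySimplex h (face i x) (omitAt i q) := by
  rw [homotopySimplex, homotopySimplex, ← face_isoSimplex hi]
  exact (app_face h i (S := C ⊗ SSet.coherentIso.{v}) (x, isoSimplex (n + 1) q)).symm

/-- The faces of a degenerate homotopy of spheres, other than the `k`-th and the `(k + 1)`-st. -/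
def degenHomotopy {n : ℕ} (x : ℕ → C _⦋n + 1⦌) (k : ℕ) (q : ℕ → Bool) (i : ℕ) : D _⦋n + 2⦌ :=
  if i < k then homotopySimplex h (degen (k - 1) (x i)) (omitAt i q)
  else homotopySimplex h (degen k (x (i - 1))) (omitAt i q)

variable {n k : ℕ} (x : ℕ → C _⦋n + 1⦌) (q : ℕ → Bool)

/-- If `x` bounded a simplex `θ`, these would be faces of `h (degen k θ, q)`. Only its faces `k` and
`k + 1` involve `θ` itself; the others are defined from `x` alone and still match. -/
lemma face_degenHomotopy (hx : Compatible x) (hk : k ≤ n + 2) {i j : ℕ} (hij : i ≤ j)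
    (hj : j ≤ n + 2) (hi : i ≠ k) (hi' : i ≠ k + 1) (hjk : j + 1 ≠ k) (hjk' : j ≠ k) :
    face i (degenHomotopy h x k q (j + 1)) = face j (degenHomotopy h x k q i) := by
  have hx' : ∀ i j, i ≤ j → j ≤ n + 1 → face i (x (j + 1)) = face j (x i) := hx
  simp only [degenHomotopy]
  rcases Nat.lt_or_ge (j + 1) k with h1 | h1
  · obtain ⟨k, rfl⟩ : ∃ l, k = l + 2 := ⟨k - 2, by omega⟩
    rw [if_pos h1, if_pos (by omega), face_homotopySimplex h (by omega),
      face_homotopySimplex h (by omega), omitAt_omitAt hij]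
    change homotopySimplex h (face i (degen (k + 1) _)) _ =
      homotopySimplex h (face j (degen (k + 1) _)) _
    rw [face_degen_of_lt (by omega) (by omega), face_degen_of_lt (by omega) (by omega),
      hx' i j hij (by omega)]
  · obtain ⟨j, rfl⟩ : ∃ l, j = l + 1 := ⟨j - 1, by omega⟩
    rw [if_neg (by omega), face_homotopySimplex h (by omega), Nat.add_sub_cancel]
    rcases Nat.lt_or_ge i k with h2 | h2
    · obtain ⟨k, rfl⟩ : ∃ l, k = l + 1 := ⟨k - 1, by omega⟩
      rw [if_pos h2, face_homotopySimplex h (by omega), omitAt_omitAt hij, Nat.add_sub_cancel,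
        face_degen_of_lt (by omega) (by omega), face_degen_of_gt (by omega) (by omega),
        hx' i j (by omega) (by omega)]
    · obtain ⟨i, rfl⟩ : ∃ l, i = l + 1 := ⟨i - 1, by omega⟩
      rw [if_neg (by omega), face_homotopySimplex h (by omega), omitAt_omitAt hij,
        Nat.add_sub_cancel, face_degen_of_gt (by omega) (by omega),
        face_degen_of_gt (by omega) (by omega), hx' i j (by omega) (by omega)]

lemma face_pred_degenHomotopy (hk : k ≤ n + 2) {i : ℕ} (hi : i < k) :
    face (k - 1) (degenHomotopy h x k q i) = homotopySimplex h (x i) (omitAt i (omitAt k q)) := by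
  obtain ⟨k, rfl⟩ : ∃ l, k = l + 1 := ⟨k - 1, by omega⟩
  rw [degenHomotopy, if_pos hi, Nat.add_sub_cancel, face_homotopySimplex h (by omega),
    omitAt_omitAt (by omega), face_degen_self (by omega)]

lemma face_degenHomotopy_of_lt (hk : k ≤ n + 2) {i : ℕ} (hi : i < k) :
    face k (degenHomotopy h x k q i) =
      homotopySimplex h (x i) (omitAt i (omitAt (k + 1) q)) := by
  obtain ⟨k, rfl⟩ : ∃ l, k = l + 1 := ⟨k - 1, by omega⟩
  rw [degenHomotopy, if_pos hi, Nat.add_sub_cancel, face_homotopySimplex h (by omega),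
    omitAt_omitAt (by omega), face_degen_succ (by omega)]

lemma face_degenHomotopy_of_gt {j : ℕ} (hkj : k < j) (hj : j ≤ n + 2) :
    face k (degenHomotopy h x k q (j + 1)) = homotopySimplex h (x j) (omitAt j (omitAt k q)) := by
  rw [degenHomotopy, if_neg (by omega), Nat.add_sub_cancel, face_homotopySimplex h (by omega),
    omitAt_omitAt (by omega), face_degen_self (by omega)]

lemma face_succ_degenHomotopy {j : ℕ} (hkj : k < j) (hj : j ≤ n + 2) :
    face (k + 1) (degenHomotopy h x k q (j + 1)) =
      homotopySimplex h (x j) (omitAt j (omitAt (k + 1) q)) := by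
  rw [degenHomotopy, if_neg (by omega), Nat.add_sub_cancel, face_homotopySimplex h (by omega),
    omitAt_omitAt (by omega), face_degen_succ (by omega)]

/-- The sphere obtained from `x` by moving its vertices along `q` has a filler. -/
def HasHomotopyFiller : Prop :=
  ∃ w : D _⦋n + 2⦌, ∀ i ≤ n + 2, face i w = homotopySimplex h (x i) (omitAt i q)

variable {x}

/-- The sequences `omitAt k q` and `omitAt (k + 1) q` differ only at `k`, so this moves one vertex
of the sphere. The given filler serves as face `k`, and the inner horn without face `k + 1` yields
the new one. -/
lemma HasHomotopyFiller.of_omitAt [D.Quasicategory] (hx : Compatible x) (hk : k < n + 2)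
    (H : HasHomotopyFiller h x (omitAt k q)) : HasHomotopyFiller h x (omitAt (k + 1) q) := by
  obtain ⟨w, hw⟩ := H
  obtain ⟨y, hy1, hy2⟩ := exists_missing_face (C := D) (n := n) (l := k + 1) (by omega) (by omega)
    (fun i ↦ if i = k then w else degenHomotopy h x k q i) (by
      intro i j hij hj hi hj'
      split_ifs with h1 h2 h2
      · omega
      · obtain rfl : k = j + 1 := h1.symm
        rw [hw i (by omega), ← face_pred_degenHomotopy h x q (by omega) (by omega),
          Nat.add_sub_cancel]
      · subst h2
        rw [hw j hj, face_degenHomotopy_of_gt h x q (by omega) hj]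
      · exact face_degenHomotopy h x q hx (by omega) hij hj h2 hi h1 (by omega))
  refine ⟨y, fun i hi ↦ ?_⟩
  rcases Nat.lt_or_ge i (k + 1) with h1 | h1
  · rw [hy1 i h1, Nat.add_sub_cancel]
    split_ifs with h2
    · subst h2
      rw [hw i hi, omitAt_omitAt le_rfl]
    · exact face_degenHomotopy_of_lt h x q (by omega) (by omega)
  · rw [hy2 i h1 hi, if_neg (by omega)]
    exact face_succ_degenHomotopy h x q h1 hi

/-- The opposite move, through the horn without face `k`. It also covers the last vertex `k = n +
2`, where the horn without face `k + 1` would be outer. -/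
lemma HasHomotopyFiller.of_omitAt_succ [D.Quasicategory] (hx : Compatible x) (h0 : 0 < k)
    (hk : k ≤ n + 2) (H : HasHomotopyFiller h x (omitAt (k + 1) q)) :
    HasHomotopyFiller h x (omitAt k q) := by
  obtain ⟨w, hw⟩ := H
  obtain ⟨y, hy1, hy2⟩ := exists_missing_face (C := D) (n := n) (l := k) h0 (by omega)
    (fun i ↦ if i = k + 1 then w else degenHomotopy h x k q i) (by
      intro i j hij hj hi hj'
      split_ifs with h1 h2 h2
      · omega
      · obtain rfl : k = j := by omega
        rw [hw i (by omega), ← face_degenHomotopy_of_lt h x q (by omega) (by omega)]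
      · subst h2
        rw [hw j hj, face_succ_degenHomotopy h x q (by omega) hj]
      · exact face_degenHomotopy h x q hx hk hij hj hi h2 hj' (by omega))
  refine ⟨y, fun i hi ↦ ?_⟩
  rcases Nat.lt_or_ge i k with h1 | h1
  · rw [hy1 i h1, if_neg (by omega)]
    exact face_pred_degenHomotopy h x q hk h1
  · rw [hy2 i h1 hi]
    split_ifs with h2
    · obtain rfl : i = k := by omega
      rw [hw i hi, omitAt_omitAt le_rfl]
    · exact face_degenHomotopy_of_gt h x q (by omega) hi

lemma HasHomotopyFiller.congr {q r : ℕ → Bool} (hqr : ∀ i ≤ n + 2, q i = r i)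
    (H : HasHomotopyFiller h x q) : HasHomotopyFiller h x r := by
  obtain ⟨w, hw⟩ := H
  refine ⟨w, fun i hi ↦ ?_⟩
  rw [hw i hi, homotopySimplex, homotopySimplex, isoSimplex_congr (r := omitAt i r)]
  intro j hj
  simp only [omitAt]
  split_ifs <;> exact hqr _ (by omega)

end

/-- Whether a sphere in a quasicategory can be filled is invariant under natural equivalence. -/
lemma NaturallyEquivalent.exists_filler {C D : SSet.{v}} [D.Quasicategory] {f g : C ⟶ D}
    (hfg : NaturallyEquivalent f g) {n : ℕ} {x : ℕ → C _⦋n + 1⦌} (hx : Compatible x)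
    (hf : ∃ w : D _⦋n + 2⦌, ∀ i ≤ n + 2, face i w = f.app (op ⦋n + 1⦌) (x i)) :
    ∃ w : D _⦋n + 2⦌, ∀ i ≤ n + 2, face i w = g.app (op ⦋n + 1⦌) (x i) := by
  obtain ⟨h, rfl, rfl⟩ := hfg
  -- Vertices are moved one at a time from the `f` end (`false`) to the `g` end (`true`), beginning
  -- with vertex `0`. The intermediate sequences run from `true` to `false`, so they use the inverse
  -- of the equivalence.
  have key (m : ℕ) (hm : m ≤ n + 2) : HasHomotopyFiller h x (fun i ↦ decide (i < m)) := by
    induction m with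
    | zero =>
      have h0 : (fun i ↦ decide (i < 0)) = fun _ ↦ false := by
        funext i
        simp
      rw [h0]
      exact hf
    | succ m ih =>
      have h1 : omitAt m (fun i ↦ decide (i < m + 1)) = fun i ↦ decide (i < m) := by
        funext i
        simp only [omitAt, decide_eq_decide]
        split_ifs <;> omega
      have h2 : omitAt (m + 1) (fun i ↦ decide (i < m + 1)) = fun i ↦ decide (i < m + 1) := by
        funext i
        simp only [omitAt, decide_eq_decide]
        split_ifs <;> omega
      rw [← h2]
      apply HasHomotopyFiller.of_omitAt h _ hx (by omega)
      rw [h1]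
      exact ih (by omega)
  have last : HasHomotopyFiller h x (omitAt (n + 2) fun i ↦ decide (i ≠ n + 2)) := by
    refine HasHomotopyFiller.of_omitAt_succ h _ hx (by omega) le_rfl
      (HasHomotopyFiller.congr h (fun i hi ↦ ?_) (key (n + 2) le_rfl))
    simp only [omitAt, decide_eq_decide]
    split_ifs <;> omega
  refine HasHomotopyFiller.congr h (r := fun _ ↦ true) (fun i hi ↦ ?_) last
  simp only [omitAt, decide_eq_true_eq]
  split_ifs <;> omega

/-! ### Spheres in essentially small ∞-categories -/

/-- A diagonal argument: a sphere `x` in an essentially small ∞-category can be filled if, for some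
inner `l`, any two simplices `a`, `b` with the same boundary occur as the `l`-th faces of families
of simplices indexed by a set `I`, as constructed from `I`-fold powers or copowers. -/
lemma exists_filler_of_comparison {C : SSet.{v}} [C.Quasicategory]
    (hC : IsEssentiallySmall.{v, w} C) {n l l' : ℕ} (h0 : 0 < l) (hl : l < n + 2)
    (hcomp : ∀ (I : Type v) [Small.{w} I] (a b : C _⦋n + 1⦌),
      (∀ i ≤ n + 1, face i a = face i b) →
      ∃ (ξ : Set I → I → C _⦋n + 2⦌) (t : Set I → C _⦋n + 1⦌),
        (∀ A i, face l' (ξ A i) = t A) ∧ (∀ A, ∀ i ∈ A, face l (ξ A i) = a) ∧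
        (∀ A, ∀ i ∉ A, face l (ξ A i) = b) ∧
        ∀ A B i, ∀ j ≤ n + 2, j ≠ l → j ≠ l' → face j (ξ A i) = face j (ξ B i))
    (x : ℕ → C _⦋n + 1⦌) (hx : Compatible x) :
    ∃ w : C _⦋n + 2⦌, ∀ i ≤ n + 2, face i w = x i := by
  have hx' : ∀ i j, i ≤ j → j ≤ n + 1 → face i (x (j + 1)) = face j (x i) := hx
  obtain ⟨D, hD, hDs, F, G, -, hGF⟩ := hC
  -- `θ` is a filler except for its face `l`, which has the boundary of `x l` and has to be
  -- exchanged for it.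
  obtain ⟨θ, hθ⟩ := exists_filler_of_inner h0 hl x fun i j hij hj _ _ ↦ hx' i j hij hj
  have hab (i : ℕ) (hi : i ≤ n + 1) : face i (face l θ) = face i (x l) := by
    rcases Nat.lt_or_ge i l with h | h
    · obtain ⟨l, rfl⟩ : ∃ k, l = k + 1 := ⟨l - 1, by omega⟩
      rw [face_face (by omega) (by omega), hθ i (by omega) (by omega),
        hx' i l (by omega) (by omega)]
    · rw [← face_face h hi, hθ (i + 1) (by omega) (by omega), hx' l i h hi]
  have : Small.{w} (D _⦋n + 1⦌) := hDs ⦋n + 1⦌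
  -- With this index set, `A ↦ G (t A)` maps the subsets of a set into that set, so it is not
  -- injective.
  obtain ⟨ξ, t, ht, ha, hb, hξ⟩ := hcomp (D _⦋n + 1⦌) (face l θ) (x l) hab
  obtain ⟨A, B, i, hGt, hiA, hiB⟩ : ∃ (A B : Set (D _⦋n + 1⦌)) (i : D _⦋n + 1⦌),
      G.app (op ⦋n + 1⦌) (t A) = G.app (op ⦋n + 1⦌) (t B) ∧ i ∈ A ∧ i ∉ B := by
    by_contra! H
    refine Function.cantor_injective (fun A ↦ G.app (op ⦋n + 1⦌) (t A)) fun A B hAB ↦ ?_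
    exact Set.Subset.antisymm (fun i hi ↦ H A B i hAB hi) (fun i hi ↦ H B A i hAB.symm hi)
  -- The simplices `t A` and `t B` are identified only after applying `G`, so the exchange takes
  -- place in the image of `G ≫ F`.
  apply hGF.exists_filler hx
  obtain ⟨θ', hθ1, hθ2⟩ := exists_replace_face h0 hl ((G ≫ F).app _ (ξ A i))
    ((G ≫ F).app _ (ξ B i)) ((G ≫ F).app _ θ) (by
      intro j hj hjl
      rw [← app_face, ← app_face]
      by_cases hjl' : j = l'
      · rw [hjl', ht, ht]
        exact congrArg (F.app (op ⦋n + 1⦌)) hGt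
      · rw [hξ A B i j hj hjl hjl'])
    (by rw [← app_face, ← app_face, ha A i hiA])
  refine ⟨θ', fun j hj ↦ ?_⟩
  by_cases hjl : j = l
  · rw [hjl, hθ1, ← app_face, hb B i hiB]
  · rw [hθ2 j hj hjl, ← app_face, hθ j hj hjl]

/-- Every sphere of dimension at least one in an essentially small ∞-category with small limits
or small colimits can be filled. -/
lemma exists_filler_of_hasSmallLimits_or_hasSmallColimits {C : SSet.{v}} [C.Quasicategory]
    (hC : IsEssentiallySmall.{v, w} C)
    (hlim : HasSmallLimits.{v, w} C ∨ HasSmallColimits.{v, w} C)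
    {n : ℕ} (x : ℕ → C _⦋n + 1⦌) (hx : Compatible x) :
    ∃ w : C _⦋n + 2⦌, ∀ i ≤ n + 2, face i w = x i := by
  rcases hlim with h | h
  -- Vertex `n + 1` of `ξ A i` is the power and vertex `n + 2` the object that is powered; omitting
  -- the power leaves `a` or `b`. For colimits, the copower is vertex `1` and the object vertex `0`.
  · refine exists_filler_of_comparison hC (l := n + 1) (l' := n + 2) (by omega) (by omega)
      (fun I _ a b hab ↦ ?_) x hx
    obtain ⟨ξ, t, h1, h2, h3, h4⟩ := h.exists_comparison I a b hab
    exact ⟨ξ, t, h1, h2, h3, fun A B i j hj hjl hjl' ↦ h4 A B i j (by omega)⟩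
  · refine exists_filler_of_comparison hC (l := 1) (l' := 0) (by omega) (by omega)
      (fun I _ a b hab ↦ ?_) x hx
    obtain ⟨ξ, t, h1, h2, h3, h4⟩ := h.exists_comparison I a b hab
    refine ⟨ξ, t, h1, h2, h3, fun A B i j hj hjl hjl' ↦ ?_⟩
    obtain ⟨j, rfl⟩ : ∃ k, j = k + 1 := ⟨j - 1, by omega⟩
    exact h4 A B i j (by omega) (by omega)

/-! ### Mapping spaces -/

section

variable {C : SSet.{v}} {X Y : C _⦋0⦌}

/-- The `(n + 1)`-simplex of `C` given by an `n`-simplex of a mapping space. -/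
def mapSimplex {n : ℕ} (z : (mapSpace X Y) _⦋n⦌) : C _⦋n + 1⦌ :=
  C.map (consIso n).hom.op (Subtype.val z)

lemma mapSimplex_injective {n : ℕ} :
    Function.Injective (mapSimplex : (mapSpace X Y) _⦋n⦌ → C _⦋n + 1⦌) := by
  intro z z' h
  apply Subtype.ext
  have := congrArg (C.map (consIso n).inv.op) h
  simpa [mapSimplex, ← Functor.map_comp_apply, ← op_comp] using this

lemma mapSimplex_face {n i : ℕ} (hi : i ≤ n + 1) (z : (mapSpace X Y) _⦋n + 1⦌) :
    mapSimplex (face i z) = face (i + 1) (mapSimplex z) := by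
  rw [face_of_lt (show i < n + 2 by omega), face_of_lt (show i + 1 < n + 3 by omega)]
  change C.map _ (C.map _ _) = C.map _ (C.map _ _)
  rw [← Functor.map_comp_apply, ← Functor.map_comp_apply, ← op_comp, ← op_comp]
  exact congrArg (fun f ↦ C.map f.op (Subtype.val z))
    (consIso_hom_comp_tensorHomOf n ⟨i, by omega⟩)

/-- The constant `n`-simplex at a vertex. -/
def constSimplex (n : ℕ) (Y : C _⦋0⦌) : C _⦋n⦌ :=
  C.map (SimplexCategory.const ⦋n⦌ ⦋0⦌ 0).op Y

lemma face_constSimplex (n i : ℕ) : face i (constSimplex (n + 1) Y) = constSimplex n Y := by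
  rw [constSimplex, constSimplex, face, SimplicialObject.δ, ← Functor.map_comp_apply, ← op_comp]
  rfl

lemma face_zero_map_consIso {n : ℕ} (c : C.obj (op (tensorObjOf ⦋0⦌ ⦋n⦌))) :
    face 0 (C.map (consIso n).hom.op c) = C.map (inr' ⦋0⦌ ⦋n⦌).op c := by
  rw [face_of_lt (show 0 < n + 2 by omega), inr'_zero_left, op_comp, Functor.map_comp_apply]
  rfl

lemma firstVertex_map_consIso {n : ℕ} (c : C.obj (op (tensorObjOf ⦋0⦌ ⦋n⦌))) :
    firstVertex (C.map (consIso n).hom.op c) = C.map (inl' ⦋0⦌ ⦋n⦌).op c := by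
  rw [inl'_zero_left, op_comp, Functor.map_comp_apply]
  rfl

lemma face_zero_mapSimplex {n : ℕ} (z : (mapSpace X Y) _⦋n⦌) :
    face 0 (mapSimplex z) = constSimplex n Y :=
  (face_zero_map_consIso _).trans z.2.2

lemma firstVertex_mapSimplex {n : ℕ} (z : (mapSpace X Y) _⦋n⦌) :
    firstVertex (mapSimplex z) = X :=
  (firstVertex_map_consIso _).trans z.2.1

lemma exists_mapSimplex {n : ℕ} (c : C _⦋n + 1⦌) (h0 : face 0 c = constSimplex n Y)
    (hX : firstVertex c = X) : ∃ z : (mapSpace X Y) _⦋n⦌, mapSimplex z = c := by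
  have hc : C.map (consIso n).hom.op (C.map (consIso n).inv.op c) = c := by
    simp [← Functor.map_comp_apply, ← op_comp]
  refine ⟨⟨C.map (consIso n).inv.op c, ?_, ?_⟩, hc⟩
  · rw [← hX, ← firstVertex_map_consIso, hc]
  · exact (face_zero_map_consIso _).symm.trans ((congrArg (face 0) hc).trans h0)

lemma delta_comp_boundary_ι {n : ℕ} {i j : Fin (n + 2)} (hij : i ≤ j) :
    SSet.stdSimplex.δ i ≫ SSet.boundary.ι.{v} j.succ =
      SSet.stdSimplex.δ j ≫ SSet.boundary.ι i.castSucc := by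
  rw [← cancel_mono (SSet.Subcomplex.ι _), Category.assoc, Category.assoc, SSet.boundary.ι_ι,
    SSet.boundary.ι_ι, SSet.stdSimplex.δ_comp_δ hij]

lemma face_yonedaEquiv {S : SSet.{v}} {n : ℕ} (g : Δ[n + 1] ⟶ S) (i : Fin (n + 2)) :
    face i.val (SSet.yonedaEquiv g) = SSet.yonedaEquiv (SSet.stdSimplex.δ i ≫ g) := by
  apply SSet.yonedaEquiv.symm.injective
  rw [← delta_comp_yoneda, Equiv.symm_apply_apply, Equiv.symm_apply_apply]

lemma compatible_of_hom {S : SSet.{v}} {n : ℕ} (f : (∂Δ[n + 1] : SSet.{v}) ⟶ S) :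
    Compatible fun i ↦ SSet.yonedaEquiv (SSet.boundary.ι (Fin.ofNat (n + 2) i) ≫ f) := by
  obtain _ | n := n
  · trivial
  · intro i j hij hj
    have h := delta_comp_boundary_ι.{v} (n := n) (i := ⟨i, by omega⟩) (j := ⟨j, by omega⟩) hij
    have hi' : Fin.ofNat (n + 1 + 2) i = (⟨i, by omega⟩ : Fin (n + 2)).castSucc := by
      ext
      simpa using Nat.mod_eq_of_lt (show i < n + 3 by omega)
    have hj' : Fin.ofNat (n + 1 + 2) (j + 1) = (⟨j, by omega⟩ : Fin (n + 2)).succ := by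
      ext
      simpa using Nat.mod_eq_of_lt (show j + 1 < n + 3 by omega)
    beta_reduce
    rw [hi', hj']
    refine (face_yonedaEquiv _ ⟨i, by omega⟩).trans (Eq.trans ?_
      (face_yonedaEquiv _ ⟨j, by omega⟩).symm)
    rw [← Category.assoc, h, Category.assoc]

/-- Mapping spaces are empty or contractible if all spheres of dimension at least one can be
filled. -/
lemma isContractible_mapSpace
    (hC : ∀ (n : ℕ) (x : ℕ → C _⦋n + 1⦌), Compatible x →
      ∃ w : C _⦋n + 2⦌, ∀ i ≤ n + 2, face i w = x i)
    (z : (mapSpace X Y) _⦋0⦌) : IsContractible (mapSpace X Y) := by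
  intro n f
  obtain _ | n := n
  -- `∂Δ⁰` is empty, so any point of the mapping space will do.
  · exact ⟨SSet.yonedaEquiv.symm z, SSet.boundary.hom_ext₀⟩
  let y (i : ℕ) : (mapSpace X Y) _⦋n⦌ :=
    SSet.yonedaEquiv (SSet.boundary.ι (Fin.ofNat (n + 2) i) ≫ f)
  have hy : Compatible y := compatible_of_hom f
  -- The sphere is coned off with `X` as the new vertex `0`, which shifts face indices by one; the
  -- constant simplex at `Y` closes it up as face `0`.
  obtain ⟨w, hw⟩ := hC n (fun i ↦ if i = 0 then constSimplex (n + 1) Y else mapSimplex (y (i - 1)))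
    (by
      intro i j hij hj
      obtain _ | i := i
      · simp [face_zero_mapSimplex, face_constSimplex]
      · simp only [Nat.add_eq_zero_iff, one_ne_zero, and_false, if_false, Nat.add_sub_cancel]
        obtain _ | n := n
        · obtain rfl : i = 0 := by
            have : j ≤ 1 := hj
            omega
          obtain rfl : j = 1 := by
            have : j ≤ 1 := hj
            omega
          rw [face_one_eq_firstVertex, face_one_eq_firstVertex, firstVertex_mapSimplex,
            firstVertex_mapSimplex]
        · obtain ⟨j, rfl⟩ : ∃ k, j = k + 1 := ⟨j - 1, by omega⟩
          have hy' : ∀ i j, i ≤ j → j ≤ n + 1 → face i (y (j + 1)) = face j (y i) := hy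
          rw [← mapSimplex_face (by omega), ← mapSimplex_face (by omega),
            hy' i j (by omega) (by omega)])
  obtain ⟨g, hg⟩ := exists_mapSimplex (X := X) (Y := Y) w (by simpa using hw 0 (by omega)) (by
    rw [← firstVertex_face (i := 0) (by omega), hw 1 (by omega)]
    exact firstVertex_mapSimplex _)
  refine ⟨SSet.yonedaEquiv.symm g, SSet.boundary.hom_ext fun i ↦ ?_⟩
  rw [boundary_ι_comp_ι_comp, Equiv.apply_symm_apply]
  have hi : y i.val = face i.val g := by
    apply mapSimplex_injective
    rw [mapSimplex_face (by omega), hg, hw (i.val + 1) (by omega)]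
    rfl
  rw [← hi, Equiv.symm_apply_apply, Fin.ofNat_val_eq_self]

end

end InftyCat

theorem mainTheorem10 (C : SSet.{max v w}) (hC : C.Quasicategory)
    (hsmall : InftyCat.IsEssentiallySmall.{max v w, w} C)
    (hlim : InftyCat.HasSmallLimits.{max v w, w} C ∨ InftyCat.HasSmallColimits.{max v w, w} C)
    (X Y : C _⦋0⦌) :
    IsEmpty ((InftyCat.mapSpace X Y) _⦋0⦌) ∨ InftyCat.IsContractible (InftyCat.mapSpace X Y) := by
  rcases isEmpty_or_nonempty ((InftyCat.mapSpace X Y) _⦋0⦌) with h | ⟨⟨z⟩⟩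
  · exact Or.inl h
  · exact Or.inr (InftyCat.isContractible_mapSpace (fun _ x hx ↦
      InftyCat.exists_filler_of_hasSmallLimits_or_hasSmallColimits hsmall hlim x hx) z)
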